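/- Let $d\ge 0$ and let $f\in\mathcal C^{2}(\mathbb R^{d};\mathbb R)$ satisfy $\alpha I_d\preceq\nabla^2 f(x)\preceq\beta I_d$ for all $x\in\mathbb R^d$, where $0<\alpha\le\beta$, and let $x^\ast=\arg\min f$. Let $\eta\in(0,1/\beta)$, $m\ge 0$ and $N\ge 1$. Let $Z_i^k$ ($1\le k\le N$, $1\le i\le m+1$) be independent $\mathcal N_d(0,I_d)$ random vectors on a probability space, and let $X_i^k$ be the $N$ independent paths of the unadjusted Langevin algorithm started at $x^\ast$: $$X_0^k=x^\ast,\qquad X_i^k=X_{i-1}^k-\eta\nabla f(X_{i-1}^k)+\sqrt{2\eta}\,Z_i^k\qquad(1\le k\le N,\ 1\le i\le m+1).$$ Let $$\tilde\Sigma_N=\frac1N\sum_{k=1}^N X_{m+1}^k(X_{m+1}^k)^\top-\Big(\frac1N\sum_{k=1}^N X_{m+1}^k\Big)\Big(\frac1N\sum_{k=1}^N X_{m+1}^k\Big)^\top$$ be the sample covariance matrix of the last iterates. Then the entries of $\tilde\Sigma_N$ are integrable, and for every $\delta>0$, with probability at least $1-4\delta$, $$\big\|\tilde\Sigma_N-\mathbb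 E[\tilde\Sigma_N]\big\|\le\frac{16}{\alpha}\left(\sqrt{\frac{9d+4\log\delta^{-1}}{N}}\;\vee\;\frac{9d+4\log\delta^{-1}}{N}\right),$$ where $\|\cdot\|$ is the operator norm with respect to the Euclidean norm, $a\vee b=\max\{a,b\}$, and $\sqrt t$ is read as $0$ for $t<0$ (which can occur only when $\delta>1$, where the claim is void). -/

import Mathlib

open MeasureTheory ProbabilityTheory

/-- `f` is `C²` on `ℝᵈ` and `α I ⪯ ∇²f(x) ⪯ β I` for all `x`, with `0 < α ≤ β`. The Loewner
inequalities are written through the quadratic form `v ↦ D²f(x)(v, v)`; the Hessian of a `C²`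
function is symmetric. -/
structure IsConvexSmoothPotential {d : ℕ} (f : EuclideanSpace ℝ (Fin d) → ℝ) (α β : ℝ) :
    Prop where
  alpha_pos : 0 < α
  alpha_le_beta : α ≤ β
  contDiff : ContDiff ℝ 2 f
  lower : ∀ x v : EuclideanSpace ℝ (Fin d), α * ‖v‖ ^ 2 ≤ iteratedFDeriv ℝ 2 f x ![v, v]
  upper : ∀ x v : EuclideanSpace ℝ (Fin d), iteratedFDeriv ℝ 2 f x ![v, v] ≤ β * ‖v‖ ^ 2

/-- The `i`-th iterate of the unadjusted Langevin algorithm for the potential `f`, with step size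
`η`, initial value `x₀` and noise sequence `z 1, z 2, …`. -/
noncomputable def ulaIterate {d : ℕ} (f : EuclideanSpace ℝ (Fin d) → ℝ) (η : ℝ)
    (x₀ : EuclideanSpace ℝ (Fin d)) (z : ℕ → EuclideanSpace ℝ (Fin d)) :
    ℕ → EuclideanSpace ℝ (Fin d)
  | 0 => x₀
  | i + 1 =>
      ulaIterate f η x₀ z i - η • gradient f (ulaIterate f η x₀ z i) + √(2 * η) • z (i + 1)

/-- The sample covariance matrix
`(1/N) ∑ₖ xₖ xₖᵀ - ((1/N) ∑ₖ xₖ) ((1/N) ∑ₖ xₖ)ᵀ` of the vectors `x₁, …, x_N`. -/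
noncomputable def sampleCovariance {d N : ℕ} (x : Fin N → EuclideanSpace ℝ (Fin d)) :
    Matrix (Fin d) (Fin d) ℝ :=
  (N : ℝ)⁻¹ • ∑ k, Matrix.vecMulVec (x k) (x k)
    - Matrix.vecMulVec ((N : ℝ)⁻¹ • ∑ k, x k) ((N : ℝ)⁻¹ • ∑ k, x k)

/-- The entrywise expectation of a random matrix. -/
noncomputable def expectedMatrix {Ω : Type*} [MeasurableSpace Ω] {d : ℕ} (P : Measure Ω)
    (A : Ω → Matrix (Fin d) (Fin d) ℝ) : Matrix (Fin d) (Fin d) ℝ :=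
  Matrix.of fun i j => ∫ ω, A ω i j ∂P

/-- The operator norm of a matrix with respect to the Euclidean norm. -/
noncomputable def matrixOpNorm {d : ℕ} (A : Matrix (Fin d) (Fin d) ℝ) : ℝ :=
  ‖Matrix.toEuclideanCLM (n := Fin d) (𝕜 := ℝ) A‖

/-- The sample covariance matrix of the last iterates `X_{m+1}^k`, `k = 1, …, N`, of the `N` chains
started at `x₀` and driven by the noises `Z k`. -/
noncomputable def parallelUlaCovariance {Ω : Type*} {d N : ℕ}
    (f : EuclideanSpace ℝ (Fin d) → ℝ) (η : ℝ) (x₀ : EuclideanSpace ℝ (Fin d)) (m : ℕ)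
    (Z : Fin N → ℕ → Ω → EuclideanSpace ℝ (Fin d)) (ω : Ω) : Matrix (Fin d) (Fin d) ℝ :=
  sampleCovariance fun k => ulaIterate f η x₀ (fun i => Z k i ω) (m + 1)

/-! All the noises together form one standard Gaussian vector `g` in a Euclidean space. A gradient
step contracts by `1 - ηα`, so the last iterates, jointly in all chains, are a Lipschitz function of
`g` with squared constant `2/α`, whatever the number of steps (`norm_ulaIterate_sub_sq_le`,
`sum_norm_chainIterate_sub_sq_le`).

For a fixed direction `v`, the quadratic form of the sample covariance is the sample variance `S` of
the projected iterates. `S` is not Lipschitz, but `√S` is a seminorm of the data divided by `√N`.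
Hence `R = √(ε + S)` is smooth and Lipschitz in `g` with squared constant `2/(αN)`, and Gaussian
concentration (`hasSubgaussianMGF_stdGaussian`) applies to it. The identity `S - E S = R² - (E R)² -
Var R`, with a Poincaré bound for `Var R` and a bound for `E R`, carries the concentration back to
`S` (`measureReal_sampleVariance_deviation_le`).

A `1/4`-net of the unit ball with at most `9^d` points and a union bound pass from fixed directions
to the operator norm (`exists_quarter_net_unitBall`, `norm_le_two_mul_of_net`). The net costs the
factor `2` in `16/α = 2 · 4 · (2/α)` and the term `9d ≥ 4 d log 9`. -/

/-! ### Gaussian concentration and a Poincaré inequality by the Maurey–Pisier argument. -/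

section GaussianConcentration

section Derivatives

variable {E : Type*} [NormedAddCommGroup E] [NormedSpace ℝ E]

/-- The rotation path joins `p.1` at `t = 0` to `p.2` at `t = 1`. Its velocity is `π/2` times the
second rotated coordinate, which for a Gaussian pair is independent of the first. -/
lemma hasDerivAt_comp_rotation_fst {F : E → ℝ} (hF : ContDiff ℝ 1 F) (p : E × E) (t : ℝ) :
    HasDerivAt (fun t : ℝ => F (ContinuousLinearMap.rotation (Real.pi / 2 * t) p).1)
      (Real.pi / 2 * fderiv ℝ F (ContinuousLinearMap.rotation (Real.pi / 2 * t) p).1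
        (ContinuousLinearMap.rotation (Real.pi / 2 * t) p).2) t := by
  have h0 : HasDerivAt (fun t : ℝ => Real.pi / 2 * t) (Real.pi / 2) t := by
    simpa using (hasDerivAt_id t).const_mul (Real.pi / 2)
  have h1 : HasDerivAt (fun t : ℝ => (ContinuousLinearMap.rotation (Real.pi / 2 * t) p).1)
      ((Real.pi / 2) • (ContinuousLinearMap.rotation (Real.pi / 2 * t) p).2) t := by
    simp only [ContinuousLinearMap.rotation_apply]
    refine ((h0.cos.smul_const p.1).add (h0.sin.smul_const p.2)).congr_deriv ?_
    module
  have h2 := ((hF.differentiable (by norm_num)) _).hasFDerivAt.comp_hasDerivAt t h1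
  simpa [Function.comp_def] using h2

lemma norm_fderiv_const_mul_le {F : E → ℝ} (hF : ContDiff ℝ 1 F) {K : ℝ}
    (hK : ∀ x, ‖fderiv ℝ F x‖ ≤ K) (t : ℝ) (x : E) :
    ‖fderiv ℝ (fun x => t * F x) x‖ ≤ |t| * K := by
  rw [fderiv_const_mul (hF.differentiable (by norm_num) x), norm_smul, Real.norm_eq_abs]
  exact mul_le_mul_of_nonneg_left (hK x) (abs_nonneg t)

/-- The increment is the average over `[0, 1]` of the derivative along the rotation path; Jensen's
inequality moves the exponential inside. -/
lemma exp_sub_le_lintegral_rotation {F : E → ℝ} (hF : ContDiff ℝ 1 F) (p : E × E) :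
    ENNReal.ofReal (Real.exp (F p.2 - F p.1)) ≤
      ∫⁻ t in Set.Icc (0 : ℝ) 1, ENNReal.ofReal (Real.exp (Real.pi / 2 *
        fderiv ℝ F (ContinuousLinearMap.rotation (Real.pi / 2 * t) p).1
          (ContinuousLinearMap.rotation (Real.pi / 2 * t) p).2)) := by
  set g : ℝ → ℝ := fun t => Real.pi / 2 *
        fderiv ℝ F (ContinuousLinearMap.rotation (Real.pi / 2 * t) p).1
          (ContinuousLinearMap.rotation (Real.pi / 2 * t) p).2 with hg
  have hF' : Continuous (fderiv ℝ F) := hF.continuous_fderiv (by norm_num)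
  have hgc : Continuous g := by
    simp only [hg, ContinuousLinearMap.rotation_apply]
    refine continuous_const.mul (Continuous.clm_apply (hF'.comp (by fun_prop)) (by fun_prop))
  have hprob : IsProbabilityMeasure (volume.restrict (Set.Icc (0 : ℝ) 1)) :=
    ⟨by simp⟩
  have hftc : F p.2 - F p.1 = ∫ t in Set.Icc (0 : ℝ) 1, g t := by
    rw [integral_Icc_eq_integral_Ioc, ← intervalIntegral.integral_of_le zero_le_one,
      intervalIntegral.integral_eq_sub_of_hasDerivAt
        (fun t _ => hasDerivAt_comp_rotation_fst hF p t) (hgc.intervalIntegrable _ _)]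
    simp [ContinuousLinearMap.rotation_apply]
  have hgi : Integrable g (volume.restrict (Set.Icc (0 : ℝ) 1)) :=
    hgc.continuousOn.integrableOn_Icc
  have hei : Integrable (fun t => Real.exp (g t)) (volume.restrict (Set.Icc (0 : ℝ) 1)) :=
    (Real.continuous_exp.comp hgc).continuousOn.integrableOn_Icc
  have hJ := convexOn_exp.map_integral_le Real.continuous_exp.continuousOn isClosed_univ
    (μ := volume.restrict (Set.Icc (0 : ℝ) 1)) (f := g) (by simp) hgi hei
  rw [hftc]
  refine (ENNReal.ofReal_le_ofReal hJ).trans ?_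
  rw [ofReal_integral_eq_lintegral_ofReal hei (ae_of_all _ fun _ => (Real.exp_pos _).le)]

end Derivatives

variable {E : Type*} [NormedAddCommGroup E] [InnerProductSpace ℝ E] [FiniteDimensional ℝ E]
  [MeasurableSpace E] [BorelSpace E]

lemma lintegral_exp_dual_stdGaussian (L : StrongDual ℝ E) :
    ∫⁻ x, ENNReal.ofReal (Real.exp (L x)) ∂(stdGaussian E)
      = ENNReal.ofReal (Real.exp (‖L‖ ^ 2 / 2)) := by
  have hmap : (stdGaussian E).map L = gaussianReal 0 (‖L‖ ^ 2).toNNReal := by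
    rw [IsGaussian.map_eq_gaussianReal, integral_strongDual_stdGaussian,
      variance_dual_stdGaussian]
  have h1 : ∫⁻ x, ENNReal.ofReal (Real.exp (L x)) ∂(stdGaussian E)
      = ∫⁻ y, ENNReal.ofReal (Real.exp y) ∂(gaussianReal 0 (‖L‖ ^ 2).toNNReal) := by
    rw [← hmap, lintegral_map (by fun_prop) (by fun_prop)]
  have hint : Integrable (fun y => Real.exp y) (gaussianReal 0 (‖L‖ ^ 2).toNNReal) := by
    simpa using integrable_exp_mul_gaussianReal (μ := 0) (v := (‖L‖ ^ 2).toNNReal) 1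
  have hmgf := congrFun (mgf_id_gaussianReal (μ := 0) (v := (‖L‖ ^ 2).toNNReal)) 1
  simp only [mgf, id, one_mul, zero_add, one_pow, mul_one,
    Real.coe_toNNReal _ (sq_nonneg ‖L‖)] at hmgf
  rw [h1, ← ofReal_integral_eq_lintegral_ofReal hint (ae_of_all _ fun _ => (Real.exp_pos _).le),
    hmgf]

/-- The Maurey–Pisier inequality for the exponential function. -/
lemma lintegral_exp_sub_le_of_norm_fderiv_le {F : E → ℝ} (hF : ContDiff ℝ 1 F) {K : ℝ}
    (hK : ∀ x, ‖fderiv ℝ F x‖ ≤ K) :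
    ∫⁻ p : E × E, ENNReal.ofReal (Real.exp (F p.2 - F p.1))
        ∂((stdGaussian E).prod (stdGaussian E))
      ≤ ENNReal.ofReal (Real.exp (Real.pi ^ 2 * K ^ 2 / 8)) := by
  set γ := stdGaussian E
  have hF' : Continuous (fderiv ℝ F) := hF.continuous_fderiv (by norm_num)
  set G : E × E → ENNReal := fun p =>
    ENNReal.ofReal (Real.exp (Real.pi / 2 * fderiv ℝ F p.1 p.2)) with hG
  have hGc : Continuous G := by
    refine ENNReal.continuous_ofReal.comp (Real.continuous_exp.comp (continuous_const.mul ?_))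
    exact (hF'.comp continuous_fst).clm_apply continuous_snd
  have hGle : ∫⁻ p, G p ∂(γ.prod γ) ≤ ENNReal.ofReal (Real.exp (Real.pi ^ 2 * K ^ 2 / 8)) := by
    rw [lintegral_prod _ hGc.measurable.aemeasurable]
    refine (lintegral_mono (g := fun _ =>
      ENNReal.ofReal (Real.exp (Real.pi ^ 2 * K ^ 2 / 8))) fun x => ?_).trans (by simp)
    -- With the first coordinate frozen, the exponent is a linear functional of a standard Gaussian,
    -- of norm at most `πK/2`.
    have h := lintegral_exp_dual_stdGaussian ((Real.pi / 2) • fderiv ℝ F x)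
    simp only [FunLike.coe_smul, Pi.smul_apply, smul_eq_mul] at h
    simp only [hG]
    rw [h]
    apply ENNReal.ofReal_le_ofReal
    apply Real.exp_le_exp.mpr
    rw [norm_smul, mul_pow, Real.norm_eq_abs, sq_abs]
    have : ‖fderiv ℝ F x‖ ^ 2 ≤ K ^ 2 := pow_le_pow_left₀ (norm_nonneg _) (hK x) 2
    nlinarith [sq_nonneg Real.pi]
  calc _ ≤ ∫⁻ p, (∫⁻ t in Set.Icc (0 : ℝ) 1,
          G (ContinuousLinearMap.rotation (Real.pi / 2 * t) p)) ∂(γ.prod γ) :=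
        lintegral_mono fun p => exp_sub_le_lintegral_rotation hF p
    _ = ∫⁻ t in Set.Icc (0 : ℝ) 1, ∫⁻ p : E × E,
          G (ContinuousLinearMap.rotation (Real.pi / 2 * t) p) ∂(γ.prod γ) := by
        apply lintegral_lintegral_swap
        refine Continuous.aemeasurable ?_
        simp only [Function.uncurry_def, ContinuousLinearMap.rotation_apply]
        exact hGc.comp (by fun_prop)
    -- The product of two centred Gaussians is rotation invariant, so the inner integral does not
    -- depend on `t`.
    _ = ∫⁻ t in Set.Icc (0 : ℝ) 1, ∫⁻ p : E × E, G p ∂(γ.prod γ) := by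
        refine lintegral_congr fun t => ?_
        have hrot := IsGaussian.map_rotation_eq_self_of_forall_strongDual_eq_zero
          (μ := γ) (fun L => integral_strongDual_stdGaussian L) (Real.pi / 2 * t)
        conv_rhs => rw [← hrot]
        rw [lintegral_map hGc.measurable (by fun_prop)]
    _ ≤ _ := by simpa using hGle

lemma integrable_exp_sub_prod_stdGaussian {F : E → ℝ} (hF : ContDiff ℝ 1 F) {K : ℝ}
    (hK : ∀ x, ‖fderiv ℝ F x‖ ≤ K) :
    Integrable (fun p : E × E => Real.exp (F p.2 - F p.1))
      ((stdGaussian E).prod (stdGaussian E)) := by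
  have hc : Continuous fun p : E × E => Real.exp (F p.2 - F p.1) :=
    Real.continuous_exp.comp ((hF.continuous.comp continuous_snd).sub
      (hF.continuous.comp continuous_fst))
  refine ⟨hc.aestronglyMeasurable, ?_⟩
  rw [hasFiniteIntegral_iff_ofReal (ae_of_all _ fun _ => (Real.exp_pos _).le)]
  exact (lintegral_exp_sub_le_of_norm_fderiv_le hF hK).trans_lt ENNReal.ofReal_lt_top

lemma integral_exp_sub_le_of_norm_fderiv_le {F : E → ℝ} (hF : ContDiff ℝ 1 F) {K : ℝ}
    (hK : ∀ x, ‖fderiv ℝ F x‖ ≤ K) :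
    ∫ p : E × E, Real.exp (F p.2 - F p.1) ∂((stdGaussian E).prod (stdGaussian E))
      ≤ Real.exp (Real.pi ^ 2 * K ^ 2 / 8) := by
  have h := lintegral_exp_sub_le_of_norm_fderiv_le hF hK
  rw [← ofReal_integral_eq_lintegral_ofReal (integrable_exp_sub_prod_stdGaussian hF hK)
    (ae_of_all _ fun _ => (Real.exp_pos _).le)] at h
  exact (ENNReal.ofReal_le_ofReal_iff (Real.exp_pos _).le).1 h

/-- The constant in the Maurey–Pisier form of Gaussian concentration. -/
noncomputable def maureyPisierConst (K : ℝ) : NNReal := (Real.pi ^ 2 * K ^ 2 / 4).toNNReal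

lemma coe_maureyPisierConst (K : ℝ) : (maureyPisierConst K : ℝ) = Real.pi ^ 2 * K ^ 2 / 4 :=
  Real.coe_toNNReal _ (by positivity)

lemma hasSubgaussianMGF_sub_prod_stdGaussian {F : E → ℝ} (hF : ContDiff ℝ 1 F) {K : ℝ}
    (hK : ∀ x, ‖fderiv ℝ F x‖ ≤ K) :
    HasSubgaussianMGF (fun p : E × E => F p.2 - F p.1) (maureyPisierConst K)
      ((stdGaussian E).prod (stdGaussian E)) := by
  have key := fun t : ℝ => integrable_exp_sub_prod_stdGaussian (contDiff_const.mul hF)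
    (norm_fderiv_const_mul_le hF hK t)
  have key2 := fun t : ℝ => integral_exp_sub_le_of_norm_fderiv_le (contDiff_const.mul hF)
    (norm_fderiv_const_mul_le hF hK t)
  simp only [← mul_sub] at key key2
  refine ⟨key, fun t => (key2 t).trans_eq ?_⟩
  rw [coe_maureyPisierConst, mul_pow, sq_abs]
  ring_nf

/-- By Fubini, `exp (t (F y - F x))` is integrable in `y` for some fixed `x`; the factor `exp (t F
x)` is then a constant. -/
lemma integrable_exp_mul_stdGaussian {F : E → ℝ} (hF : ContDiff ℝ 1 F) {K : ℝ}
    (hK : ∀ x, ‖fderiv ℝ F x‖ ≤ K) (t : ℝ) :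
    Integrable (fun x => Real.exp (t * F x)) (stdGaussian E) := by
  have h := (hasSubgaussianMGF_sub_prod_stdGaussian hF hK).integrable_exp_mul t
  obtain ⟨x, hx⟩ := h.prod_right_ae.exists
  refine (hx.const_mul (Real.exp (t * F x))).congr (ae_of_all _ fun y => ?_)
  simp only [← Real.exp_add]
  ring_nf

lemma memLp_two_of_norm_fderiv_le {F : E → ℝ} (hF : ContDiff ℝ 1 F) {K : ℝ}
    (hK : ∀ x, ‖fderiv ℝ F x‖ ≤ K) : MemLp F 2 (stdGaussian E) := by
  have : integrableExpSet F (stdGaussian E) = Set.univ :=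
    Set.eq_univ_of_forall fun t => integrable_exp_mul_stdGaussian hF hK t
  exact memLp_of_mem_interior_integrableExpSet (by simp [this]) 2

/-- Gaussian concentration for `C¹` functions with bounded derivative. -/
lemma hasSubgaussianMGF_stdGaussian {F : E → ℝ} (hF : ContDiff ℝ 1 F) {K : ℝ}
    (hK : ∀ x, ‖fderiv ℝ F x‖ ≤ K) :
    HasSubgaussianMGF (fun x => F x - ∫ y, F y ∂(stdGaussian E)) (maureyPisierConst K)
      (stdGaussian E) := by
  set m := ∫ y, F y ∂(stdGaussian E)
  have hexp := integrable_exp_mul_stdGaussian hF hK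
  have hFi : Integrable F (stdGaussian E) := (memLp_two_of_norm_fderiv_le hF hK).integrable
    (by norm_num)
  have heq : ∀ t : ℝ, (fun x => Real.exp (t * (F x - m)))
      = fun x => Real.exp (-t * m) * Real.exp (t * F x) := fun t => by
    ext x
    rw [← Real.exp_add]
    ring_nf
  refine ⟨fun t => ?_, fun t => ?_⟩
  · rw [heq]
    exact (hexp t).const_mul _
  -- An independent copy replaces the mean: Jensen bounds `exp (-t m)` by the expectation of `exp
  -- (-t F)` over the copy.
  · have hJ : Real.exp (-t * m) ≤ ∫ x, Real.exp (-t * F x) ∂(stdGaussian E) := by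
      have := convexOn_exp.map_integral_le Real.continuous_exp.continuousOn isClosed_univ
        (μ := stdGaussian E) (f := fun x => -t * F x) (by simp) (hFi.const_mul _) (hexp (-t))
      rwa [integral_const_mul] at this
    have h := (hasSubgaussianMGF_sub_prod_stdGaussian hF hK).mgf_le t
    refine le_trans ?_ h
    have heq2 : (fun p : E × E => Real.exp (t * (F p.2 - F p.1)))
        = fun p => Real.exp (-t * F p.1) * Real.exp (t * F p.2) := by
      ext p
      rw [← Real.exp_add]
      ring_nf
    rw [mgf, mgf, heq, heq2, integral_const_mul,
      integral_prod_mul (fun x => Real.exp (-t * F x)) (fun x => Real.exp (t * F x))]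
    exact mul_le_mul_of_nonneg_right hJ (integral_nonneg fun _ => (Real.exp_pos _).le)

lemma sq_le_exp_add_exp_neg_sub_two (x : ℝ) : x ^ 2 ≤ Real.exp x + Real.exp (-x) - 2 := by
  have h1 : Real.exp x + Real.exp (-x) - 2 = 4 * Real.sinh (x / 2) ^ 2 := by
    have h2 : Real.exp x = Real.exp (x / 2) ^ 2 := by rw [← Real.exp_nat_mul]; ring_nf
    have h3 : Real.exp (-x) = Real.exp (-(x / 2)) ^ 2 := by rw [← Real.exp_nat_mul]; ring_nf
    have h4 : Real.exp (x / 2) * Real.exp (-(x / 2)) = 1 := by rw [← Real.exp_add]; simp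
    rw [Real.sinh_eq, h2, h3]
    linear_combination 2 * h4
  have h5 : |x / 2| ≤ |Real.sinh (x / 2)| := by
    rw [Real.abs_sinh]
    exact Real.self_le_sinh_iff.2 (abs_nonneg _)
  have h6 := sq_le_sq.2 h5
  rw [h1]
  nlinarith

/-- Adding the moment generating function bounds at `t` and `-t` gives `t² E X² ≤ 2 (exp (c t²/2) -
1)`. Dividing by `t²` and letting `t → 0` along `t² = 1/(n+1)` yields `c`. -/
lemma integral_sq_le_of_hasSubgaussianMGF {Ω : Type*} [MeasurableSpace Ω] {μ : Measure Ω}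
    [IsProbabilityMeasure μ] {X : Ω → ℝ} {c : NNReal} (h : HasSubgaussianMGF X c μ) :
    ∫ ω, X ω ^ 2 ∂μ ≤ c := by
  set v := ∫ ω, X ω ^ 2 ∂μ
  have hX2 : Integrable (fun ω => X ω ^ 2) μ := (h.memLp 2).integrable_sq
  have key : ∀ t : ℝ, t ^ 2 * v ≤ 2 * (Real.exp (c * t ^ 2 / 2) - 1) := fun t => by
    have h1 : t ^ 2 * v ≤ mgf X μ t + mgf X μ (-t) - 2 := by
      have ha : Integrable (fun ω => Real.exp (t * X ω) + Real.exp (-t * X ω)) μ :=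
        (h.integrable_exp_mul t).add (h.integrable_exp_mul (-t))
      have : ∫ ω, t ^ 2 * X ω ^ 2 ∂μ ≤
          ∫ ω, ((Real.exp (t * X ω) + Real.exp (-t * X ω)) - 2) ∂μ := by
        refine integral_mono (hX2.const_mul _) (ha.sub (integrable_const 2)) fun ω => ?_
        have := sq_le_exp_add_exp_neg_sub_two (t * X ω)
        simp only [mul_pow, neg_mul] at this ⊢
        exact this
      rw [integral_const_mul, integral_sub ha (integrable_const _),
        integral_add (h.integrable_exp_mul t) (h.integrable_exp_mul (-t))] at this
      simpa [mgf] using this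
    have h2 := h.mgf_le t
    have h3 := h.mgf_le (-t)
    rw [neg_sq] at h3
    linarith
  have hlim : Filter.Tendsto (fun n : ℕ => (c : ℝ) + c ^ 2 / 2 * (1 / ((n : ℝ) + 1)))
      Filter.atTop (nhds ((c : ℝ) + c ^ 2 / 2 * 0)) :=
    (tendsto_one_div_add_atTop_nhds_zero_nat.const_mul _).const_add _
  rw [mul_zero, add_zero] at hlim
  refine ge_of_tendsto hlim ?_
  have hsmall : ∀ᶠ n : ℕ in Filter.atTop, (c : ℝ) / 2 * (1 / ((n : ℝ) + 1)) < 1 := by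
    have := (tendsto_one_div_add_atTop_nhds_zero_nat (𝕜 := ℝ)).const_mul ((c : ℝ) / 2)
    rw [mul_zero] at this
    exact this.eventually_lt_const one_pos
  filter_upwards [hsmall] with n hn
  set s : ℝ := 1 / ((n : ℝ) + 1)
  have hs : 0 < s := by positivity
  have h1 := key (√s)
  rw [Real.sq_sqrt hs.le] at h1
  have hu0 : 0 ≤ (c : ℝ) * s / 2 := by positivity
  have hexp := Real.abs_exp_sub_one_sub_id_le (x := c * s / 2)
    (by rw [abs_of_nonneg hu0]; linarith)
  have h2 := (abs_le.1 hexp).2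
  have h3 : s * v ≤ s * (c + c ^ 2 / 2 * s) := by nlinarith
  exact le_of_mul_le_mul_left h3 hs

/-- The Poincaré inequality for the Gaussian measure, with a non-optimal constant. -/
lemma variance_stdGaussian_le {F : E → ℝ} (hF : ContDiff ℝ 1 F) {K : ℝ}
    (hK : ∀ x, ‖fderiv ℝ F x‖ ≤ K) :
    Var[F; stdGaussian E] ≤ Real.pi ^ 2 * K ^ 2 / 8 := by
  have h := integral_sq_le_of_hasSubgaussianMGF (hasSubgaussianMGF_sub_prod_stdGaussian hF hK)
  have h2 := memLp_two_of_norm_fderiv_le hF hK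
  have hi := h2.integrable (q := 2) (by norm_num)
  have hs := h2.integrable_sq
  -- The second moment of the difference of two independent copies is twice the variance; this
  -- halves the constant `π²K²/4`.
  have heq : ∫ p : E × E, (F p.2 - F p.1) ^ 2 ∂((stdGaussian E).prod (stdGaussian E))
      = 2 * Var[F; stdGaussian E] := by
    have e : (fun p : E × E => (F p.2 - F p.1) ^ 2)
        = fun p => (F p.2 ^ 2 + F p.1 ^ 2) - 2 * (F p.1 * F p.2) := by ext p; ring
    have ha : Integrable (fun p : E × E => F p.2 ^ 2 + F p.1 ^ 2)
        ((stdGaussian E).prod (stdGaussian E)) := (hs.comp_snd _).add (hs.comp_fst _)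
    rw [e, integral_sub ha ((hi.mul_prod hi).const_mul 2),
      integral_add (hs.comp_snd _) (hs.comp_fst _), integral_const_mul,
      integral_prod_mul (fun x => F x) (fun x => F x), variance_eq_sub h2,
      integral_fun_snd (fun x => F x ^ 2), integral_fun_fst (fun x => F x ^ 2)]
    simp
    ring
  rw [heq, coe_maureyPisierConst] at h
  linarith

end GaussianConcentration

/-! ### Nets of the unit ball and operator norms. -/

section Nets

open scoped NNReal ENNReal

variable {E : Type*} [NormedAddCommGroup E]

/-- A `1/4`-separated finite set in the unit ball has cardinality at most `9 ^ dim`. -/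
lemma card_le_of_separated_quarter [NormedSpace ℝ E] [FiniteDimensional ℝ E] (s : Finset E)
    (hs : ∀ c ∈ s, ‖c‖ ≤ 1)
    (h : ∀ c ∈ s, ∀ d ∈ s, c ≠ d → 1 / 4 ≤ ‖c - d‖) : s.card ≤ 9 ^ Module.finrank ℝ E := by
  borelize E
  let μ : Measure E := Measure.addHaar
  -- Disjoint balls of radius `1/8` fit in the ball of radius `9/8`; the volume ratio is `9 ^ dim`.
  set A := ⋃ c ∈ s, Metric.ball (c : E) (1 / 8) with hA
  have D : Set.Pairwise (s : Set E) 
      (Function.onFun Disjoint fun c => Metric.ball (c : E) (1 / 8)) := by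
    rintro c hc d hd hcd
    apply Metric.ball_disjoint_ball
    rw [dist_eq_norm]
    linarith [h c hc d hd hcd]
  have A_subset : A ⊆ Metric.ball (0 : E) (9 / 8) := by
    refine Set.iUnion₂_subset fun x hx => Metric.ball_subset_ball' ?_
    rw [dist_zero_right]
    linarith [hs x hx]
  have I : (s.card : ℝ≥0∞) * ENNReal.ofReal ((1 / 8) ^ Module.finrank ℝ E) *
        μ (Metric.ball 0 1) ≤
      ENNReal.ofReal ((9 / 8) ^ Module.finrank ℝ E) * μ (Metric.ball 0 1) :=
    calc
      _ = μ A := by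
        rw [hA, measure_biUnion_finset D fun c _ => measurableSet_ball]
        simp only [μ.addHaar_ball_of_pos _ (show (0 : ℝ) < 1 / 8 by norm_num)]
        simp only [Finset.sum_const, nsmul_eq_mul, mul_assoc]
      _ ≤ μ (Metric.ball (0 : E) (9 / 8)) := measure_mono A_subset
      _ = _ := by
        simp only [μ.addHaar_ball_of_pos _ (show (0 : ℝ) < 9 / 8 by norm_num)]
  have J := (ENNReal.mul_le_mul_iff_left (Metric.measure_ball_pos _ _ zero_lt_one).ne'
    measure_ball_lt_top.ne).1 I
  have K : (s.card : ℝ) ≤ (9 : ℝ) ^ Module.finrank ℝ E := by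
    have := ENNReal.toReal_le_of_le_ofReal (by positivity) J
    rw [ENNReal.toReal_mul, ENNReal.toReal_ofReal (by positivity), div_pow, div_pow, one_pow,
      ENNReal.toReal_natCast, mul_one_div] at this
    exact (div_le_div_iff_of_pos_right (by positivity)).1 this
  exact mod_cast K

/-- A separated set of maximal cardinality is a net: a point far from all its elements could be
added. -/
lemma exists_quarter_net_unitBall [NormedSpace ℝ E] [FiniteDimensional ℝ E] :
    ∃ T : Finset E, T.card ≤ 9 ^ Module.finrank ℝ E ∧ (∀ v ∈ T, ‖v‖ ≤ 1) ∧
      ∀ x : E, ‖x‖ ≤ 1 → ∃ v ∈ T, ‖x - v‖ ≤ 1 / 4 := by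
  classical
  let Q : Finset E → Prop := fun s => (∀ c ∈ s, ‖c‖ ≤ 1) ∧
    ∀ c ∈ s, ∀ d ∈ s, c ≠ d → 1 / 4 ≤ ‖c - d‖
  let S : Set ℕ := {n | ∃ s : Finset E, Q s ∧ s.card = n}
  have hne : S.Nonempty := ⟨0, ∅, by simp [Q]⟩
  have hbdd : BddAbove S := by
    refine ⟨9 ^ Module.finrank ℝ E, ?_⟩
    rintro n ⟨s, hs, rfl⟩
    exact card_le_of_separated_quarter s hs.1 hs.2
  obtain ⟨T, hT, hcard⟩ := Nat.sSup_mem hne hbdd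
  refine ⟨T, card_le_of_separated_quarter T hT.1 hT.2, hT.1, fun x hx => ?_⟩
  by_contra! hfar
  have hxT : x ∉ T := fun hmem => by
    have := hfar x hmem
    norm_num at this
  have hQ : Q (insert x T) := by
    refine ⟨by simpa [hx] using hT.1, ?_⟩
    intro c hc d hd hcd
    rcases Finset.mem_insert.1 hc with rfl | hc' <;> rcases Finset.mem_insert.1 hd with rfl | hd'
    · exact absurd rfl hcd
    · exact (hfar d hd').le
    · rw [norm_sub_rev]
      exact (hfar c hc').le
    · exact hT.2 c hc' d hd' hcd
  have := le_csSup hbdd ⟨insert x T, hQ, rfl⟩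
  rw [Finset.card_insert_of_notMem hxT, hcard] at this
  omega

lemma norm_le_of_abs_inner_le [InnerProductSpace ℝ E] {A : E →L[ℝ] E}
    (hA : (A : E →ₗ[ℝ] E).IsSymmetric) {M : ℝ} (hM0 : 0 ≤ M)
    (hM : ∀ x, |inner ℝ (A x) x| ≤ M * ‖x‖ ^ 2) : ‖A‖ ≤ M := by
  rw [ContinuousLinearMap.norm_eq_iSup_rayleighQuotient A hA]
  refine ciSup_le fun x => ?_
  by_cases hx : x = 0
  · subst hx
    simpa using hM0
  · have hx' : 0 < ‖x‖ ^ 2 := by positivity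
    rw [ContinuousLinearMap.rayleighQuotient, ContinuousLinearMap.reApplyInnerSelf_apply,
      RCLike.re_to_real, abs_div, abs_of_pos hx', div_le_iff₀ hx']
    exact hM x

/-- The norm of a self-adjoint operator is controlled by its quadratic form on a `1/4`-net. -/
lemma norm_le_two_mul_of_net [InnerProductSpace ℝ E] {A : E →L[ℝ] E}
    (hA : (A : E →ₗ[ℝ] E).IsSymmetric) {T : Finset E} (hT1 : ∀ v ∈ T, ‖v‖ ≤ 1)
    (hT : ∀ x : E, ‖x‖ ≤ 1 → ∃ v ∈ T, ‖x - v‖ ≤ 1 / 4) {M : ℝ}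
    (hM : ∀ v ∈ T, |inner ℝ (A v) v| ≤ M) : ‖A‖ ≤ 2 * M := by
  -- Replacing `x` by a net point in each of the two slots costs `‖A‖/4`. The resulting `‖A‖ ≤ M +
  -- ‖A‖/2` is solved for `‖A‖`.
  have hball : ∀ x : E, ‖x‖ ≤ 1 → |inner ℝ (A x) x| ≤ M + ‖A‖ / 2 := fun x hx => by
    obtain ⟨v, hv, hxv⟩ := hT x hx
    have hsplit : inner ℝ (A x) x = inner ℝ (A v) v + inner ℝ (A (x - v)) x
        + inner ℝ (A v) (x - v) := by
      simp only [map_sub, inner_sub_left, inner_sub_right]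
      ring
    have hA0 := norm_nonneg A
    have b1 : |inner ℝ (A (x - v)) x| ≤ ‖A‖ / 4 := by
      refine (abs_real_inner_le_norm _ _).trans ?_
      have := A.le_opNorm (x - v)
      have h0 := norm_nonneg (A (x - v))
      nlinarith [norm_nonneg x, mul_le_mul_of_nonneg_left hxv hA0]
    have b2 : |inner ℝ (A v) (x - v)| ≤ ‖A‖ / 4 := by
      refine (abs_real_inner_le_norm _ _).trans ?_
      have h1 := A.le_opNorm v
      have h2 := mul_le_mul_of_nonneg_left (hT1 v hv) hA0
      have h3 : ‖A v‖ ≤ ‖A‖ := by linarith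
      have := mul_le_mul h3 hxv (norm_nonneg _) hA0
      linarith
    rw [hsplit]
    have t1 := abs_add_le (inner ℝ (A v) v + inner ℝ (A (x - v)) x) (inner ℝ (A v) (x - v))
    have t2 := abs_add_le (inner ℝ (A v) v) (inner ℝ (A (x - v)) x)
    linarith [hM v hv]
  have h0 : 0 ≤ M + ‖A‖ / 2 := (abs_nonneg _).trans (hball 0 (by simp))
  have hle : ‖A‖ ≤ M + ‖A‖ / 2 := norm_le_of_abs_inner_le hA h0 fun x => by
    by_cases hx : x = 0
    · simp [hx]
    · have hx' : 0 < ‖x‖ := norm_pos_iff.2 hx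
      have := hball (‖x‖⁻¹ • x) (by rw [norm_smul, norm_inv, norm_norm, inv_mul_cancel₀ hx'.ne'])
      rw [map_smul, real_inner_smul_left, real_inner_smul_right, ← mul_assoc, abs_mul,
        abs_of_pos (by positivity), ← mul_inv, inv_mul_le_iff₀ (by positivity)] at this
      linarith
  linarith

end Nets

/-! ### Contraction of the Langevin recursion and its dependence on the noise. -/

section Langevin

variable {d : ℕ} {f : EuclideanSpace ℝ (Fin d) → ℝ} {α β η : ℝ}

lemma contDiff_gradient (hf : ContDiff ℝ 2 f) : ContDiff ℝ 1 (gradient f) := by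
  have h : gradient f = (InnerProductSpace.toDual ℝ (EuclideanSpace ℝ (Fin d))).symm ∘
      fderiv ℝ f := rfl
  rw [h]
  exact (LinearIsometryEquiv.contDiff _).comp (hf.fderiv_right (by norm_num))

lemma inner_fderiv_gradient (hf : ContDiff ℝ 2 f) (x v w : EuclideanSpace ℝ (Fin d)) :
    inner ℝ (fderiv ℝ (gradient f) x v) w = iteratedFDeriv ℝ 2 f x ![v, w] := by
  have h : (fun y => inner ℝ (gradient f y) w) = fun y => fderiv ℝ f y w := by
    ext y
    exact inner_gradient_left
  have hd : DifferentiableAt ℝ (gradient f) x :=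
    (contDiff_gradient hf).differentiable (by norm_num) x
  have hd2 : DifferentiableAt ℝ (fderiv ℝ f) x :=
    (hf.fderiv_right (m := 1) (by norm_num)).differentiable (by norm_num) x
  have h1 : fderiv ℝ (fun y => inner ℝ (gradient f y) w) x v
      = inner ℝ (fderiv ℝ (gradient f) x v) w := by
    rw [fderiv_inner_apply ℝ hd (differentiableAt_const w)]
    simp
  have h2 : fderiv ℝ (fun y => fderiv ℝ f y w) x v = fderiv ℝ (fderiv ℝ f) x v w := by
    rw [fderiv_clm_apply hd2 (differentiableAt_const w)]
    simp
  rw [← h1, h, h2, iteratedFDeriv_two_apply]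
  simp

/-- A gradient descent step with a small step size is a contraction. -/
lemma norm_gradientStep_sub_le (hf : IsConvexSmoothPotential f α β) (hη0 : 0 < η)
    (hηβ : η * β < 1) (x y : EuclideanSpace ℝ (Fin d)) :
    ‖(x - η • gradient f x) - (y - η • gradient f y)‖ ≤ (1 - η * α) * ‖x - y‖ := by
  have hg := contDiff_gradient hf.contDiff
  have hgd : ∀ z, DifferentiableAt ℝ (gradient f) z := fun z =>
    hg.differentiable (by norm_num) z
  have hder : ∀ z, fderiv ℝ (fun x => x - η • gradient f x) z
      = ContinuousLinearMap.id ℝ _ - η • fderiv ℝ (gradient f) z := fun z =>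
    ((hasFDerivAt_id z).sub ((hgd z).hasFDerivAt.const_smul η)).fderiv
  have hηα : η * α < 1 :=
    (mul_le_mul_of_nonneg_left hf.alpha_le_beta hη0.le).trans_lt hηβ
  refine Convex.norm_image_sub_le_of_norm_fderiv_le (𝕜 := ℝ) (s := Set.univ)
    (f := fun x => x - η • gradient f x)
    (fun z _ => differentiableAt_fun_id.sub ((hgd z).const_smul η)) (fun z _ => ?_)
    convex_univ (Set.mem_univ y) (Set.mem_univ x)
  rw [hder]
  -- The derivative `I - η∇²f` is symmetric with quadratic form between `1 - ηβ > 0` and `1 - ηα`,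
  -- hence has norm at most `1 - ηα`.
  refine norm_le_of_abs_inner_le ?_ (by linarith) fun v => ?_
  · intro v w
    have hsymm : inner ℝ (fderiv ℝ (gradient f) z v) w
        = inner ℝ (fderiv ℝ (gradient f) z w) v := by
      rw [inner_fderiv_gradient hf.contDiff, inner_fderiv_gradient hf.contDiff]
      simp only [iteratedFDeriv_two_apply]
      exact (hf.contDiff.contDiffAt.isSymmSndFDerivAt (by simp)).eq v w
    simp only [ContinuousLinearMap.coe_coe, FunLike.coe_sub, FunLike.coe_smul, Pi.sub_apply,
      Pi.smul_apply, ContinuousLinearMap.id_apply, inner_sub_left, inner_sub_right,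
      real_inner_smul_left, real_inner_smul_right, hsymm]
    rw [real_inner_comm v (fderiv ℝ (gradient f) z w)]
  · have h1 := hf.lower z v
    have h2 := hf.upper z v
    rw [← inner_fderiv_gradient hf.contDiff] at h1 h2
    simp only [FunLike.coe_sub, FunLike.coe_smul, Pi.sub_apply,
      Pi.smul_apply, ContinuousLinearMap.id_apply, inner_sub_left,
      real_inner_smul_left, real_inner_self_eq_norm_sq]
    have h3 := mul_le_mul_of_nonneg_left h1 hη0.le
    have h4 := mul_le_mul_of_nonneg_left h2 hη0.le
    rw [abs_of_nonneg]
    · linarith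
    · nlinarith [sq_nonneg ‖v‖]

/-- Working with squares keeps the constant free of `n` and `η`: the step `(1-ηα)a + √(2η)b` is a
convex combination of `a` and `√(2η)b/(ηα)`, so its square is at most `(1-ηα)a² + (2/α)b²`. -/
lemma norm_ulaIterate_sub_sq_le (hf : IsConvexSmoothPotential f α β) (hη0 : 0 < η)
    (hηβ : η * β < 1) (x₀ : EuclideanSpace ℝ (Fin d)) (z z' : ℕ → EuclideanSpace ℝ (Fin d))
    (n : ℕ) :
    ‖ulaIterate f η x₀ z n - ulaIterate f η x₀ z' n‖ ^ 2
      ≤ 2 / α * ∑ i ∈ Finset.range n, ‖z (i + 1) - z' (i + 1)‖ ^ 2 := by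
  have hα := hf.alpha_pos
  have hηα : η * α < 1 :=
    (mul_le_mul_of_nonneg_left hf.alpha_le_beta hη0.le).trans_lt hηβ
  induction n with
  | zero => simp [ulaIterate]
  | succ n ih =>
    rw [Finset.sum_range_succ, mul_add]
    set X := ulaIterate f η x₀ z n
    set X' := ulaIterate f η x₀ z' n
    set b := ‖z (n + 1) - z' (n + 1)‖
    have hstep : ‖ulaIterate f η x₀ z (n + 1) - ulaIterate f η x₀ z' (n + 1)‖
        ≤ (1 - η * α) * ‖X - X'‖ + √(2 * η) * b := by
      have e : ulaIterate f η x₀ z (n + 1) - ulaIterate f η x₀ z' (n + 1)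
          = ((X - η • gradient f X) - (X' - η • gradient f X'))
            + √(2 * η) • (z (n + 1) - z' (n + 1)) := by
        simp only [ulaIterate, X, X', smul_sub]
        abel
      rw [e]
      refine (norm_add_le _ _).trans (add_le_add (norm_gradientStep_sub_le hf hη0 hηβ X X') ?_)
      rw [norm_smul, Real.norm_eq_abs, abs_of_nonneg (Real.sqrt_nonneg _)]
    have hsq := pow_le_pow_left₀ (norm_nonneg _) hstep 2
    have hc : √(2 * η) ^ 2 = 2 * η := Real.sq_sqrt (by positivity)
    have hηα0 : 0 < η * α := by positivity
    -- The exact defect in the convexity inequality for the square with weights `1 - ηα` and `ηα`.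
    have hid : (1 - η * α) * ‖X - X'‖ ^ 2 + 2 / α * b ^ 2
        - ((1 - η * α) * ‖X - X'‖ + √(2 * η) * b) ^ 2
        = (1 - η * α) / (η * α) * (η * α * ‖X - X'‖ - √(2 * η) * b) ^ 2 := by
      have e2 : 2 / α * b ^ 2 = √(2 * η) ^ 2 * b ^ 2 / (η * α) := by
        rw [hc]
        field_simp
      rw [e2]
      field_simp
      ring
    have hpos : 0 ≤ (1 - η * α) / (η * α) * (η * α * ‖X - X'‖ - √(2 * η) * b) ^ 2 :=
      mul_nonneg (div_nonneg (by linarith) hηα0.le) (sq_nonneg _)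
    have hmono : (1 - η * α) * ‖X - X'‖ ^ 2 ≤ ‖X - X'‖ ^ 2 := by
      nlinarith [sq_nonneg ‖X - X'‖]
    linarith

lemma contDiff_ulaIterate {G : Type*} [NormedAddCommGroup G] [NormedSpace ℝ G]
    (hf : ContDiff ℝ 2 f) (x₀ : EuclideanSpace ℝ (Fin d))
    {z : G → ℕ → EuclideanSpace ℝ (Fin d)} (hz : ∀ i, ContDiff ℝ 1 fun g => z g i) (n : ℕ) :
    ContDiff ℝ 1 fun g => ulaIterate f η x₀ (z g) n := by
  induction n with
  | zero => exact contDiff_const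
  | succ n ih =>
    simp only [ulaIterate]
    exact (ih.sub (((contDiff_gradient hf).comp ih).const_smul η)).add ((hz _).const_smul _)

lemma ulaIterate_congr (x₀ : EuclideanSpace ℝ (Fin d)) {z z' : ℕ → EuclideanSpace ℝ (Fin d)}
    {n : ℕ} (h : ∀ i < n, z (i + 1) = z' (i + 1)) :
    ulaIterate f η x₀ z n = ulaIterate f η x₀ z' n := by
  induction n with
  | zero => rfl
  | succ n ih =>
    simp only [ulaIterate, ih fun i hi => h i (hi.trans n.lt_succ_self), h n n.lt_succ_self]

end Langevin

/-! ### Sample variance and the Lipschitz property of its square root. -/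

section SampleVariance

/-- The sample variance of the real numbers `x₁, …, x_N`. -/
noncomputable def sampleVariance {N : ℕ} (x : Fin N → ℝ) : ℝ :=
  (N : ℝ)⁻¹ * ∑ k, x k ^ 2 - ((N : ℝ)⁻¹ * ∑ k, x k) ^ 2

variable {N : ℕ}

lemma sampleVariance_eq (hN : 1 ≤ N) (x : Fin N → ℝ) (c : ℝ) :
    sampleVariance x = (N : ℝ)⁻¹ * ∑ k, (x k - c) ^ 2 - ((N : ℝ)⁻¹ * ∑ k, x k - c) ^ 2 := by
  have hN' : (N : ℝ) ≠ 0 := by positivity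
  have h : ∑ k, (x k - c) ^ 2 = ∑ k, x k ^ 2 - 2 * c * ∑ k, x k + N * c ^ 2 := by
    simp only [sub_sq, Finset.sum_add_distrib, Finset.sum_sub_distrib, Finset.mul_sum]
    simp only [Finset.sum_const, Finset.card_univ, Fintype.card_fin, nsmul_eq_mul]
    congr 2
    exact Finset.sum_congr rfl fun _ _ => by ring
  rw [h, sampleVariance]
  field_simp
  ring

lemma sampleVariance_le (hN : 1 ≤ N) (x : Fin N → ℝ) (c : ℝ) :
    sampleVariance x ≤ (N : ℝ)⁻¹ * ∑ k, (x k - c) ^ 2 := by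
  rw [sampleVariance_eq hN x c]
  linarith [sq_nonneg ((N : ℝ)⁻¹ * ∑ k, x k - c)]

/-- The vector inside the norm is linear in `x`, so `√(sampleVariance x)` is a seminorm and the
reverse triangle inequality applies to it. -/
lemma sampleVariance_eq_norm_sq (hN : 1 ≤ N) (x : Fin N → ℝ) :
    sampleVariance x
      = ‖WithLp.toLp 2 fun j => (√(N : ℝ))⁻¹ * (x j - (N : ℝ)⁻¹ * ∑ k, x k)‖ ^ 2 := by
  rw [sampleVariance_eq hN x ((N : ℝ)⁻¹ * ∑ k, x k), EuclideanSpace.norm_sq_eq, Finset.mul_sum]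
  simp [mul_pow, Real.sq_sqrt]

lemma sampleVariance_nonneg (hN : 1 ≤ N) (x : Fin N → ℝ) : 0 ≤ sampleVariance x := by
  rw [sampleVariance_eq_norm_sq hN]
  positivity

/-- `√(ε + a²)` is the norm of `(√ε, a)`; `h3` is the Cauchy–Schwarz inequality for two such
vectors. -/
lemma abs_sqrt_add_sq_sub_le {ε : ℝ} (hε : 0 ≤ ε) {a b : ℝ} :
    |√(ε + a ^ 2) - √(ε + b ^ 2)| ≤ |a - b| := by
  apply abs_le_of_sq_le_sq _ (abs_nonneg _)
  have h1 : √(ε + a ^ 2) ^ 2 = ε + a ^ 2 := Real.sq_sqrt (by positivity)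
  have h2 : √(ε + b ^ 2) ^ 2 = ε + b ^ 2 := Real.sq_sqrt (by positivity)
  have h3 : ε + a * b ≤ √(ε + a ^ 2) * √(ε + b ^ 2) := by
    rw [← Real.sqrt_mul (by positivity)]
    apply Real.le_sqrt_of_sq_le
    nlinarith [mul_nonneg hε (sq_nonneg (a - b))]
  rw [sq_abs]
  nlinarith

lemma abs_sqrt_add_sampleVariance_sub_le (hN : 1 ≤ N) {ε : ℝ} (hε : 0 ≤ ε) (x y : Fin N → ℝ) :
    |√(ε + sampleVariance x) - √(ε + sampleVariance y)|
      ≤ √((N : ℝ)⁻¹ * ∑ k, (x k - y k) ^ 2) := by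
  have hxy := sampleVariance_le hN (fun k => x k - y k) 0
  simp only [sub_zero] at hxy
  refine le_trans ?_ (Real.sqrt_le_sqrt hxy)
  rw [sampleVariance_eq_norm_sq hN x, sampleVariance_eq_norm_sq hN y,
    sampleVariance_eq_norm_sq hN, Real.sqrt_sq (norm_nonneg _)]
  refine (abs_sqrt_add_sq_sub_le hε).trans
    ((abs_norm_sub_norm_le _ _).trans_eq ?_)
  congr 1
  ext j
  simp only [PiLp.sub_apply, Finset.sum_sub_distrib]
  ring

end SampleVariance

lemma norm_fderiv_le_of_abs_sub_le {G : Type*} [NormedAddCommGroup G] [NormedSpace ℝ G]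
    {F : G → ℝ} {K : ℝ} (hK : 0 ≤ K)
    (h : ∀ g g', |F g - F g'| ≤ K * ‖g - g'‖) (g : G) : ‖fderiv ℝ F g‖ ≤ K := by
  have : LipschitzWith ⟨K, hK⟩ F := LipschitzWith.of_dist_le_mul fun a b => by
    rw [Real.dist_eq, dist_eq_norm]
    exact h a b
  exact norm_fderiv_le_of_lipschitz ℝ this

/-! ### Concentration of the sample variance. -/

section SampleVarianceConcentration

variable {G : Type*} [NormedAddCommGroup G] [InnerProductSpace ℝ G] [FiniteDimensional ℝ G]
  [MeasurableSpace G] [BorelSpace G] {N : ℕ}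

lemma measureReal_abs_sub_integral_ge_le {F : G → ℝ} (hF : ContDiff ℝ 1 F) {K : ℝ}
    (hK : ∀ x, ‖fderiv ℝ F x‖ ≤ K) {r : ℝ} (hr : 0 ≤ r) :
    (stdGaussian G).real {g | r ≤ |F g - ∫ y, F y ∂(stdGaussian G)|}
      ≤ 2 * Real.exp (-r ^ 2 / (2 * (Real.pi ^ 2 * K ^ 2 / 4))) := by
  have h := hasSubgaussianMGF_stdGaussian hF hK
  have h1 := h.measure_ge_le hr
  have h2 := h.neg.measure_ge_le hr
  rw [coe_maureyPisierConst] at h1 h2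
  have hsub : {g | r ≤ |F g - ∫ y, F y ∂(stdGaussian G)|}
      ⊆ {g | r ≤ F g - ∫ y, F y ∂(stdGaussian G)}
        ∪ {g | r ≤ (-fun g => F g - ∫ y, F y ∂(stdGaussian G)) g} := fun g hg => by
    rcases le_abs.1 (show r ≤ |_| from hg) with h | h
    · exact Or.inl h
    · exact Or.inr h
  refine (measureReal_mono hsub).trans ((measureReal_union_le _ _).trans ?_)
  linarith

lemma integral_sampleVariance_le (hN : 1 ≤ N) {x : Fin N → G → ℝ}
    (hx : ∀ k, ContDiff ℝ 1 (x k)) {K : ℝ} (hK : ∀ k g, ‖fderiv ℝ (x k) g‖ ≤ K) {c : ℝ}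
    (hc : ∀ k, ∫ g, x k g ∂(stdGaussian G) = c) :
    ∫ g, sampleVariance (fun k => x k g) ∂(stdGaussian G) ≤ Real.pi ^ 2 * K ^ 2 / 8 := by
  have hmem : ∀ k, MemLp (x k) 2 (stdGaussian G) := fun k =>
    memLp_two_of_norm_fderiv_le (hx k) (hK k)
  have hint : ∀ k, Integrable (fun g => (x k g - c) ^ 2) (stdGaussian G) := fun k =>
    ((hmem k).sub (memLp_const c)).integrable_sq
  have hsum : Integrable (fun g => (N : ℝ)⁻¹ * ∑ k, (x k g - c) ^ 2) (stdGaussian G) :=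
    (integrable_finsetSum _ fun k _ => hint k).const_mul _
  have hN' : (N : ℝ) ≠ 0 := by positivity
  calc _ ≤ ∫ g, (N : ℝ)⁻¹ * ∑ k, (x k g - c) ^ 2 ∂(stdGaussian G) :=
        integral_mono_of_nonneg (ae_of_all _ fun g => sampleVariance_nonneg hN _) hsum
          (ae_of_all _ fun g => sampleVariance_le hN _ c)
    _ = (N : ℝ)⁻¹ * ∑ k, Var[x k; stdGaussian G] := by
        rw [integral_const_mul, integral_finsetSum _ fun k _ => hint k]
        congr 1
        refine Finset.sum_congr rfl fun k _ => ?_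
        rw [variance_eq_integral (hx k).continuous.aemeasurable, hc k]
    _ ≤ (N : ℝ)⁻¹ * ∑ _k : Fin N, Real.pi ^ 2 * K ^ 2 / 8 := by
        refine mul_le_mul_of_nonneg_left (Finset.sum_le_sum fun k _ => ?_) (by positivity)
        exact variance_stdGaussian_le (hx k) (hK k)
    _ = _ := by
        simp
        field_simp

lemma integrable_sampleVariance {Ω : Type*} [MeasurableSpace Ω] {μ : Measure Ω}
    {x : Fin N → Ω → ℝ} (hx : ∀ k, MemLp (x k) 2 μ) :
    Integrable (fun g => sampleVariance fun k => x k g) μ := by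
  refine ((integrable_finsetSum _ fun k _ => (hx k).integrable_sq).const_mul _).sub ?_
  exact ((memLp_finsetSum _ fun k _ => hx k).const_mul _).integrable_sq

/-- Here `2.55² ≥ 1.3 · 5`, so the left side is at most `s(5.1 q + 5 q²)`. The two terms of the
maximum cross at `q = 1/2`, where this is `3.8 s` against `4 s`. -/
lemma two_mul_add_sq_le_max {q s m r : ℝ} (hq : 0 ≤ q) (hs : 0 < s)
    (hm2 : m ^ 2 ≤ 1.3 * s) (hr2 : r ^ 2 = 5 * s * q ^ 2) :
    2 * m * r + r ^ 2 ≤ 4 * s * max (2 * q) (4 * q ^ 2) := by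
  have hmr : m * r ≤ 2.55 * s * q := by
    refine abs_le_of_sq_le_sq' ?_ (by positivity) |>.2
    rw [mul_pow, hr2]
    have : m ^ 2 * (5 * s * q ^ 2) ≤ 1.3 * s * (5 * s * q ^ 2) :=
      mul_le_mul_of_nonneg_right hm2 (by positivity)
    nlinarith [mul_nonneg (sq_nonneg s) (sq_nonneg q)]
  rw [hr2]
  rcases le_total q (1 / 2) with h | h
  · have h1 : 4 * s * (2 * q) ≤ 4 * s * max (2 * q) (4 * q ^ 2) :=
      mul_le_mul_of_nonneg_left (le_max_left _ _) (by positivity)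
    nlinarith [mul_nonneg hs.le hq, mul_nonneg (mul_nonneg hs.le hq) (sub_nonneg.2 h)]
  · have h1 : 4 * s * (4 * q ^ 2) ≤ 4 * s * max (2 * q) (4 * q ^ 2) :=
      mul_le_mul_of_nonneg_left (le_max_right _ _) (by positivity)
    nlinarith [mul_nonneg hs.le hq, mul_nonneg (mul_nonneg hs.le hq) (sub_nonneg.2 h)]

lemma abs_sq_sub_le {R m r V : ℝ} (hR : 0 ≤ R) (hm : 0 ≤ m) (hRm : |R - m| ≤ r)
    (hV0 : 0 ≤ V) (hV : V ≤ r ^ 2) : |R ^ 2 - (m ^ 2 + V)| ≤ 2 * m * r + r ^ 2 := by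
  obtain ⟨h1, h2⟩ := abs_le.1 hRm
  have hr : 0 ≤ r := (abs_nonneg _).trans hRm
  rw [abs_le]
  constructor
  · rcases le_total m r with h | h
    · nlinarith [mul_nonneg hm (sub_nonneg.2 h), sq_nonneg R]
    · nlinarith [mul_nonneg hm hr]
  · nlinarith

/-- Concentration of the sample variance of smooth functions of a Gaussian vector that are
jointly Lipschitz and have a common mean. -/
lemma measureReal_sampleVariance_deviation_le (hN : 1 ≤ N) {x : Fin N → G → ℝ}
    (hx : ∀ k, ContDiff ℝ 1 (x k)) {s : ℝ} (hs : 0 < s)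
    (hlip : ∀ g g', ∑ k, (x k g - x k g') ^ 2 ≤ s * ‖g - g'‖ ^ 2) {c : ℝ}
    (hc : ∀ k, ∫ g, x k g ∂(stdGaussian G) = c) {t : ℝ} (ht : 1 ≤ t) :
    (stdGaussian G).real {g | 4 * s * max √(4 * t / N) (4 * t / N) <
        |sampleVariance (fun k => x k g)
          - ∫ g', sampleVariance (fun k => x k g') ∂(stdGaussian G)|}
      ≤ 2 * Real.exp (-t) := by
  set γ := stdGaussian G
  have hN0 : (0 : ℝ) < N := by positivity
  -- Every use below needs only `π² ≤ 10`.
  have hpi2 : Real.pi ^ 2 ≤ 9.88 := by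
    have := Real.pi_lt_d4
    nlinarith [Real.pi_pos]
  have hK : ∀ k g, ‖fderiv ℝ (x k) g‖ ≤ √s := fun k => by
    refine norm_fderiv_le_of_abs_sub_le (Real.sqrt_nonneg _) fun g g' => ?_
    rw [← Real.sqrt_sq (norm_nonneg (g - g')), ← Real.sqrt_mul hs.le]
    apply Real.abs_le_sqrt
    refine le_trans ?_ (hlip g g')
    exact Finset.single_le_sum (f := fun k => (x k g - x k g') ^ 2)
      (fun _ _ => sq_nonneg _) (Finset.mem_univ k)
  set S : G → ℝ := fun g => sampleVariance fun k => x k g with hS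
  have hS0 : ∀ g, 0 ≤ S g := fun g => sampleVariance_nonneg hN _
  have hSsm : ContDiff ℝ 1 S := by
    simp only [hS, sampleVariance]
    exact (contDiff_const.mul (ContDiff.sum fun k _ => (hx k).pow 2)).sub
      ((contDiff_const.mul (ContDiff.sum fun k _ => hx k)).pow 2)
  have hSint : Integrable S γ :=
    integrable_sampleVariance fun k => memLp_two_of_norm_fderiv_le (hx k) (hK k)
  have hSle : ∫ g, S g ∂γ ≤ Real.pi ^ 2 * s / 8 := by
    have := integral_sampleVariance_le hN hx hK hc
    rwa [Real.sq_sqrt hs.le] at this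
  -- The shift `s/20` makes the square root differentiable where `S = 0`. It is small enough that
  -- `m² ≤ s/20 + π²s/8 ≤ 1.3 s`.
  set R : G → ℝ := fun g => √(s / 20 + S g) with hR
  have hR2 : ∀ g, R g ^ 2 = s / 20 + S g := fun g => Real.sq_sqrt (by linarith [hS0 g])
  have hRsm : ContDiff ℝ 1 R :=
    (contDiff_const.add hSsm).sqrt fun g => by linarith [hS0 g]
  have hRK : ∀ g, ‖fderiv ℝ R g‖ ≤ √(s / N) := by
    refine norm_fderiv_le_of_abs_sub_le (Real.sqrt_nonneg _) fun g g' => ?_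
    refine (abs_sqrt_add_sampleVariance_sub_le hN (by positivity) _ _).trans ?_
    rw [← Real.sqrt_sq (norm_nonneg (g - g')), ← Real.sqrt_mul (by positivity)]
    apply Real.sqrt_le_sqrt
    rw [div_mul_eq_mul_div, inv_mul_eq_div]
    exact div_le_div_of_nonneg_right (hlip g g') hN0.le
  set m := ∫ g, R g ∂γ with hm
  have hm0 : 0 ≤ m := integral_nonneg fun g => Real.sqrt_nonneg _
  have hvar : Var[R; γ] ≤ Real.pi ^ 2 * (s / N) / 8 := by
    have := variance_stdGaussian_le hRsm hRK
    rwa [Real.sq_sqrt (by positivity)] at this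
  have hvar0 := variance_nonneg R γ
  have hvareq : m ^ 2 + Var[R; γ] = s / 20 + ∫ g, S g ∂γ := by
    rw [variance_eq_sub (memLp_two_of_norm_fderiv_le hRsm hRK)]
    have : ∫ g, (R ^ 2) g ∂γ = s / 20 + ∫ g, S g ∂γ := by
      simp only [Pi.pow_apply, hR2]
      rw [integral_add (integrable_const _) hSint]
      simp
    rw [this]
    ring
  have hm2 : m ^ 2 ≤ 1.3 * s := by nlinarith
  set q : ℝ := √(t / N) with hq
  have hq2 : q ^ 2 = t / N := Real.sq_sqrt (by positivity)
  -- The factor `5 ≥ π²/2` makes the tail bound at `r` at most `2 exp (-t)`; with `t ≥ 1` it also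
  -- gives `Var R ≤ r²`.
  set r : ℝ := √(5 * s * q ^ 2) with hr
  have hr2 : r ^ 2 = 5 * s * q ^ 2 := Real.sq_sqrt (by positivity)
  have hVr : Var[R; γ] ≤ r ^ 2 := by
    rw [hr2, hq2]
    refine hvar.trans ?_
    have h1 : 5 * s * (t / N) = s / N * (5 * t) := by ring
    have h2 : Real.pi ^ 2 * (s / N) / 8 = s / N * (Real.pi ^ 2 / 8) := by ring
    rw [h1, h2]
    exact mul_le_mul_of_nonneg_left (by linarith) (by positivity)
  have hmax : max √(4 * t / N) (4 * t / N) = max (2 * q) (4 * q ^ 2) := by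
    have h4 : √(4 * t / N) = 2 * q := by
      rw [mul_div_assoc, Real.sqrt_mul (by norm_num), show (4 : ℝ) = 2 ^ 2 by norm_num,
        Real.sqrt_sq (by norm_num)]
    rw [h4, hq2, mul_div_assoc]
  have htail := measureReal_abs_sub_integral_ge_le hRsm hRK (Real.sqrt_nonneg (5 * s * q ^ 2))
  refine (measureReal_mono ?_).trans (htail.trans ?_)
  · intro g hg
    by_contra hcon
    simp only [Set.mem_ofPred_eq, not_le] at hcon
    have h1 := abs_sq_sub_le (Real.sqrt_nonneg _) hm0 hcon.le hvar0 hVr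
    have h2 := two_mul_add_sq_le_max (Real.sqrt_nonneg _) hs hm2 hr2
    have h3 : R g ^ 2 - (m ^ 2 + Var[R; γ]) = S g - ∫ g', S g' ∂γ := by
      rw [hR2, hvareq]
      ring
    rw [h3] at h1
    rw [Set.mem_ofPred_eq, hmax] at hg
    exact absurd (h1.trans h2) (not_le.2 hg)
  · rw [Real.sq_sqrt (by positivity), Real.sq_sqrt (x := s / N) (by positivity), hq2]
    refine mul_le_mul_of_nonneg_left (Real.exp_le_exp.2 ?_) (by norm_num)
    rw [neg_div, neg_le_neg_iff, le_div_iff₀ (by positivity)]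
    have : t * (2 * (Real.pi ^ 2 * (s / N) / 4)) = (s * (t / N)) * (Real.pi ^ 2 / 2) := by ring
    rw [this]
    have h5 : 5 * s * (t / N) = (s * (t / N)) * 5 := by ring
    rw [h5]
    exact mul_le_mul_of_nonneg_left (by linarith) (by positivity)

end SampleVarianceConcentration

/-! ### Quadratic forms of the sample covariance and of its expectation. -/

section QuadraticForm

variable {d N : ℕ}

lemma inner_toEuclideanCLM (A : Matrix (Fin d) (Fin d) ℝ) (v w : EuclideanSpace ℝ (Fin d)) :
    inner ℝ (Matrix.toEuclideanCLM (n := Fin d) (𝕜 := ℝ) A v) w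
      = ∑ a, ∑ b, A a b * (v b * w a) := by
  simp only [PiLp.inner_apply, Matrix.ofLp_toEuclideanCLM, Matrix.mulVec, dotProduct,
    RCLike.inner_apply, conj_trivial, Finset.mul_sum]
  exact Finset.sum_congr rfl fun a _ => Finset.sum_congr rfl fun b _ => by ring

lemma isSymmetric_toEuclideanCLM {A : Matrix (Fin d) (Fin d) ℝ} (hA : ∀ a b, A a b = A b a) :
    (Matrix.toEuclideanCLM (n := Fin d) (𝕜 := ℝ) A :
      EuclideanSpace ℝ (Fin d) →ₗ[ℝ] EuclideanSpace ℝ (Fin d)).IsSymmetric := by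
  intro v w
  simp only [ContinuousLinearMap.coe_coe]
  rw [real_inner_comm _ v, inner_toEuclideanCLM, inner_toEuclideanCLM, Finset.sum_comm]
  refine Finset.sum_congr rfl fun a _ => Finset.sum_congr rfl fun b _ => ?_
  rw [hA b a]
  ring

lemma sampleCovariance_apply (x : Fin N → EuclideanSpace ℝ (Fin d)) (a b : Fin d) :
    sampleCovariance x a b
      = (N : ℝ)⁻¹ * ∑ k, x k a * x k b - ((N : ℝ)⁻¹ * ∑ k, x k a) * ((N : ℝ)⁻¹ * ∑ k, x k b) := by
  simp [sampleCovariance, Matrix.vecMulVec_apply, Matrix.sum_apply]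
  ring

lemma sampleCovariance_comm (x : Fin N → EuclideanSpace ℝ (Fin d)) (a b : Fin d) :
    sampleCovariance x a b = sampleCovariance x b a := by
  simp only [sampleCovariance_apply, mul_comm]

lemma inner_sampleCovariance (x : Fin N → EuclideanSpace ℝ (Fin d))
    (v : EuclideanSpace ℝ (Fin d)) :
    inner ℝ (Matrix.toEuclideanCLM (n := Fin d) (𝕜 := ℝ) (sampleCovariance x) v) v
      = sampleVariance fun k => inner ℝ (x k) v := by
  have h1 : ∀ k, inner ℝ (x k) v ^ 2 = ∑ a, ∑ b, x k a * x k b * (v b * v a) := fun k => by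
    rw [sq, PiLp.inner_apply, Finset.sum_mul_sum]
    simp only [RCLike.inner_apply, conj_trivial]
    exact Finset.sum_congr rfl fun a _ => Finset.sum_congr rfl fun b _ => by ring
  have h2 : ∑ k, inner ℝ (x k) v = ∑ a, (∑ k, x k a) * v a := by
    simp only [PiLp.inner_apply, RCLike.inner_apply, conj_trivial, Finset.sum_mul]
    rw [Finset.sum_comm]
    exact Finset.sum_congr rfl fun a _ => Finset.sum_congr rfl fun b _ => by ring
  have h3 : ∑ k, inner ℝ (x k) v ^ 2 = ∑ a, ∑ b, (∑ k, x k a * x k b) * (v b * v a) := by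
    simp only [h1, Finset.sum_mul]
    rw [Finset.sum_comm]
    exact Finset.sum_congr rfl fun a _ => Finset.sum_comm
  rw [inner_toEuclideanCLM, sampleVariance, h2, h3, mul_pow, sq (∑ a, _), Finset.sum_mul_sum]
  simp only [Finset.mul_sum, ← Finset.sum_sub_distrib]
  refine Finset.sum_congr rfl fun a _ => Finset.sum_congr rfl fun b _ => ?_
  rw [sampleCovariance_apply]
  ring

variable {Ω : Type*} [MeasurableSpace Ω] {P : Measure Ω}

lemma inner_expectedMatrix {A : Ω → Matrix (Fin d) (Fin d) ℝ}
    (hA : ∀ a b, Integrable (fun ω => A ω a b) P) (v : EuclideanSpace ℝ (Fin d)) :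
    inner ℝ (Matrix.toEuclideanCLM (n := Fin d) (𝕜 := ℝ) (expectedMatrix P A) v) v
      = ∫ ω, inner ℝ (Matrix.toEuclideanCLM (n := Fin d) (𝕜 := ℝ) (A ω) v) v ∂P := by
  simp only [inner_toEuclideanCLM]
  rw [integral_finsetSum _ fun a _ => integrable_finsetSum _ fun b _ => (hA a b).mul_const _]
  refine Finset.sum_congr rfl fun a _ => ?_
  rw [integral_finsetSum _ fun b _ => (hA a b).mul_const _]
  refine Finset.sum_congr rfl fun b _ => ?_
  rw [integral_mul_const]
  rfl

lemma integrable_sampleCovariance_apply {x : Fin N → Ω → EuclideanSpace ℝ (Fin d)}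
    (hx : ∀ k a, MemLp (fun ω => x k ω a) 2 P) (a b : Fin d) :
    Integrable (fun ω => sampleCovariance (fun k => x k ω) a b) P := by
  simp only [sampleCovariance_apply]
  refine ((integrable_finsetSum _ fun k _ => (hx k a).integrable_mul (hx k b)).const_mul _).sub ?_
  exact ((memLp_finsetSum _ fun k _ => hx k a).const_mul _).integrable_mul
    ((memLp_finsetSum _ fun k _ => hx k b).const_mul _)

end QuadraticForm

/-! ### The chains as functions of one standard Gaussian vector. -/

section NoiseSpace

/-- The space of all the Gaussian noises that drive `N` chains for `m + 1` steps. -/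
abbrev NoiseSpace (d m N : ℕ) : Type :=
  PiLp 2 fun _ : Fin N × Fin (m + 1) => EuclideanSpace ℝ (Fin d)

variable {d m N : ℕ}

/-- The characteristic function factors over the coordinates, and the squared `ℓ²` norm is additive
over them. -/
lemma map_toLp_pi_stdGaussian {ι F : Type*} [Fintype ι] [NormedAddCommGroup F]
    [InnerProductSpace ℝ F] [FiniteDimensional ℝ F] [MeasurableSpace F] [BorelSpace F] :
    (Measure.pi fun _ : ι => stdGaussian F).map (WithLp.toLp 2)
      = stdGaussian (PiLp 2 fun _ : ι => F) := by
  have : IsProbabilityMeasure ((Measure.pi fun _ : ι => stdGaussian F).map (WithLp.toLp 2)) :=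
    Measure.isProbabilityMeasure_map (by fun_prop)
  refine Measure.ext_of_charFun (funext fun t => ?_)
  rw [charFun_pi]
  simp only [charFun_stdGaussian]
  rw [← Complex.exp_sum]
  congr 1
  rw [← Complex.ofReal_pow, PiLp.norm_sq_eq_of_L2]
  push_cast
  rw [← Finset.sum_div, Finset.sum_neg_distrib]

lemma map_noise_eq_stdGaussian {Ω : Type*} [MeasurableSpace Ω] {P : Measure Ω}
    [IsProbabilityMeasure P] {Z : Fin N → ℕ → Ω → EuclideanSpace ℝ (Fin d)}
    (hZlaw : ∀ k, ∀ i ∈ Finset.Icc 1 (m + 1),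
      HasLaw (Z k i) (stdGaussian (EuclideanSpace ℝ (Fin d))) P)
    (hZindep : iIndepFun (fun p : Fin N × Fin (m + 1) => Z p.1 ((p.2 : ℕ) + 1)) P) :
    HasLaw (fun ω => (WithLp.toLp 2 fun p : Fin N × Fin (m + 1) => Z p.1 ((p.2 : ℕ) + 1) ω :
      NoiseSpace d m N)) (stdGaussian (NoiseSpace d m N)) P := by
  have hlaw : ∀ p : Fin N × Fin (m + 1), HasLaw (Z p.1 ((p.2 : ℕ) + 1))
      (stdGaussian (EuclideanSpace ℝ (Fin d))) P := fun p =>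
    hZlaw _ _ (Finset.mem_Icc.2 ⟨by omega, by omega⟩)
  have hm : AEMeasurable (fun ω (p : Fin N × Fin (m + 1)) => Z p.1 ((p.2 : ℕ) + 1) ω) P :=
    aemeasurable_pi_lambda _ fun p => (hlaw p).aemeasurable
  have hmap := (iIndepFun_iff_map_fun_eq_pi_map fun p => (hlaw p).aemeasurable).1 hZindep
  simp only [fun p => (hlaw p).map_eq] at hmap
  have hLp : Measurable (WithLp.toLp 2 : (Fin N × Fin (m + 1) → EuclideanSpace ℝ (Fin d)) →
    NoiseSpace d m N) := by fun_prop
  refine ⟨hLp.comp_aemeasurable hm, ?_⟩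
  rw [← map_toLp_pi_stdGaussian, ← hmap, AEMeasurable.map_map_of_aemeasurable
    hLp.aemeasurable hm]
  rfl

/-- The last iterate of the `k`-th chain as a function of all the noises. -/
noncomputable def chainIterate (f : EuclideanSpace ℝ (Fin d) → ℝ) (η : ℝ)
    (x₀ : EuclideanSpace ℝ (Fin d)) (k : Fin N) (g : NoiseSpace d m N) :
    EuclideanSpace ℝ (Fin d) :=
  ulaIterate f η x₀ (fun i => g (k, Fin.ofNat (m + 1) (i - 1))) (m + 1)

variable {f : EuclideanSpace ℝ (Fin d) → ℝ} {α β η : ℝ} {x₀ : EuclideanSpace ℝ (Fin d)}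

lemma contDiff_chainIterate (hf : ContDiff ℝ 2 f) (k : Fin N) :
    ContDiff ℝ 1 (chainIterate (m := m) f η x₀ k) :=
  contDiff_ulaIterate hf x₀ (fun i => by fun_prop) (m + 1)

/-- Each chain reads only its own block of noises, so summing over the chains does not enlarge the
constant. -/
lemma sum_norm_chainIterate_sub_sq_le (hf : IsConvexSmoothPotential f α β) (hη0 : 0 < η)
    (hηβ : η * β < 1) (g g' : NoiseSpace d m N) :
    ∑ k, ‖chainIterate f η x₀ k g - chainIterate f η x₀ k g'‖ ^ 2 ≤ 2 / α * ‖g - g'‖ ^ 2 := by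
  rw [PiLp.norm_sq_eq_of_L2, Fintype.sum_prod_type, Finset.mul_sum]
  refine Finset.sum_le_sum fun k _ => ?_
  refine (norm_ulaIterate_sub_sq_le hf hη0 hηβ x₀ _ _ (m + 1)).trans_eq ?_
  rw [Finset.sum_range]
  simp

/-- Swapping the noise blocks of the chains `k` and `l` is a linear isometry, which preserves the
standard Gaussian. -/
lemma integral_inner_chainIterate_eq (hf : ContDiff ℝ 2 f) (k l : Fin N)
    (v : EuclideanSpace ℝ (Fin d)) :
    ∫ g, inner ℝ (chainIterate f η x₀ k g) v ∂(stdGaussian (NoiseSpace d m N))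
      = ∫ g, inner ℝ (chainIterate f η x₀ l g) v ∂(stdGaussian (NoiseSpace d m N)) := by
  let U : NoiseSpace d m N ≃ₗᵢ[ℝ] NoiseSpace d m N :=
    LinearIsometryEquiv.piLpCongrLeft 2 ℝ (EuclideanSpace ℝ (Fin d))
      ((Equiv.swap k l).prodCongr (Equiv.refl (Fin (m + 1))))
  have hU : ∀ g, chainIterate f η x₀ k (U g) = chainIterate f η x₀ l g := fun g => by
    simp [chainIterate, U, LinearIsometryEquiv.piLpCongrLeft_apply, Equiv.piCongrLeft',
      Equiv.prodCongr_symm]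
  have hc : Continuous fun g : NoiseSpace d m N => inner ℝ (chainIterate f η x₀ k g) v :=
    (contDiff_chainIterate hf k).continuous.inner continuous_const
  conv_lhs => rw [← stdGaussian_map U]
  rw [integral_map U.continuous.aemeasurable hc.aestronglyMeasurable]
  simp only [hU]

lemma parallelUlaCovariance_eq {Ω : Type*} (Z : Fin N → ℕ → Ω → EuclideanSpace ℝ (Fin d))
    (ω : Ω) :
    parallelUlaCovariance f η x₀ m Z ω = sampleCovariance fun k => chainIterate f η x₀ k
      (WithLp.toLp 2 fun p : Fin N × Fin (m + 1) => Z p.1 ((p.2 : ℕ) + 1) ω) := by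
  unfold parallelUlaCovariance chainIterate
  congr 1
  funext k
  refine ulaIterate_congr x₀ fun i hi => ?_
  simp [Nat.mod_eq_of_lt hi]

end NoiseSpace

/-! ### Projected chains, and auxiliary estimates for the union bound. -/

section Chains

variable {d m N : ℕ} {f : EuclideanSpace ℝ (Fin d) → ℝ} {α β η : ℝ}
  {x₀ : EuclideanSpace ℝ (Fin d)}

lemma contDiff_inner_chainIterate (hf : ContDiff ℝ 2 f) (k : Fin N)
    (v : EuclideanSpace ℝ (Fin d)) :
    ContDiff ℝ 1 fun g : NoiseSpace d m N => inner ℝ (chainIterate f η x₀ k g) v :=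
  (contDiff_chainIterate hf k).inner ℝ contDiff_const

lemma sum_inner_chainIterate_sub_sq_le (hf : IsConvexSmoothPotential f α β) (hη0 : 0 < η)
    (hηβ : η * β < 1) {v : EuclideanSpace ℝ (Fin d)} (hv : ‖v‖ ≤ 1) (g g' : NoiseSpace d m N) :
    ∑ k, (inner ℝ (chainIterate f η x₀ k g) v - inner ℝ (chainIterate f η x₀ k g') v) ^ 2
      ≤ 2 / α * ‖g - g'‖ ^ 2 := by
  refine le_trans (Finset.sum_le_sum fun k _ => ?_)
    (sum_norm_chainIterate_sub_sq_le (x₀ := x₀) hf hη0 hηβ g g')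
  rw [← inner_sub_left, ← sq_abs]
  refine pow_le_pow_left₀ (abs_nonneg _) ((abs_real_inner_le_norm _ _).trans ?_) 2
  exact mul_le_of_le_one_right (norm_nonneg _) hv

lemma memLp_chainIterate_apply (hf : IsConvexSmoothPotential f α β) (hη0 : 0 < η)
    (hηβ : η * β < 1) (k : Fin N) (a : Fin d) :
    MemLp (fun g : NoiseSpace d m N => chainIterate f η x₀ k g a) 2
      (stdGaussian (NoiseSpace d m N)) := by
  have hα := hf.alpha_pos
  have h : (fun g : NoiseSpace d m N => chainIterate f η x₀ k g a)
      = fun g => inner ℝ (chainIterate f η x₀ k g) (EuclideanSpace.single a 1) := by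
    ext g
    simp [PiLp.inner_apply]
  rw [h]
  refine memLp_two_of_norm_fderiv_le (contDiff_inner_chainIterate hf.contDiff k _)
    (norm_fderiv_le_of_abs_sub_le (K := √(2 / α)) (Real.sqrt_nonneg _) fun g g' => ?_)
  rw [← Real.sqrt_sq (norm_nonneg (g - g')), ← Real.sqrt_mul (by positivity)]
  apply Real.abs_le_sqrt
  refine le_trans ?_ (sum_inner_chainIterate_sub_sq_le (x₀ := x₀) hf hη0 hηβ
    (v := EuclideanSpace.single a 1) (by simp) g g')
  exact Finset.single_le_sum (f := fun k => (inner ℝ (chainIterate f η x₀ k g) _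
    - inner ℝ (chainIterate f η x₀ k g') _) ^ 2) (fun _ _ => sq_nonneg _) (Finset.mem_univ k)

lemma continuous_sampleCovariance_chainIterate_apply (hf : ContDiff ℝ 2 f) (a b : Fin d) :
    Continuous fun g : NoiseSpace d m N =>
      sampleCovariance (fun k => chainIterate f η x₀ k g) a b := by
  have h : ∀ k a, Continuous fun g : NoiseSpace d m N => chainIterate f η x₀ k g a :=
    fun k a => (EuclideanSpace.proj a : EuclideanSpace ℝ (Fin d) →L[ℝ] ℝ).continuous.comp
      (contDiff_chainIterate hf k).continuous
  simp only [sampleCovariance_apply]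
  exact (continuous_const.mul (continuous_finsetSum _ fun k _ => (h k a).mul (h k b))).sub
    ((continuous_const.mul (continuous_finsetSum _ fun k _ => h k a)).mul
      (continuous_const.mul (continuous_finsetSum _ fun k _ => h k b)))

lemma continuous_sampleVariance_chainIterate (hf : ContDiff ℝ 2 f)
    (v : EuclideanSpace ℝ (Fin d)) :
    Continuous fun g : NoiseSpace d m N =>
      sampleVariance fun k => inner ℝ (chainIterate f η x₀ k g) v := by
  have h := fun k : Fin N => (contDiff_inner_chainIterate (m := m) (η := η) (x₀ := x₀) hf k
    v).continuous
  simp only [sampleVariance]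
  fun_prop

lemma log_nine_le : Real.log 9 ≤ 9 / 4 := by
  have h1 : (9 : ℝ) ^ 4 ≤ Real.exp 9 := by
    have h2 : Real.exp 9 = Real.exp 1 ^ 9 := by rw [← Real.exp_nat_mul]; norm_num
    rw [h2]
    have h3 : (2.7 : ℝ) ≤ Real.exp 1 := by linarith [Real.exp_one_gt_d9]
    refine le_trans (by norm_num) (pow_le_pow_left₀ (by norm_num) h3 9)
  have h4 := Real.log_le_log (by norm_num) h1
  rw [Real.log_exp, Real.log_pow] at h4
  push_cast at h4
  linarith

lemma one_sub_le_measureReal_of_compl_le {Ω : Type*} [MeasurableSpace Ω] {P : Measure Ω}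
    [IsProbabilityMeasure P] {s : Set Ω} {p : ℝ} (h : P.real sᶜ ≤ p) : 1 - p ≤ P.real s := by
  have := measureReal_union_le (μ := P) s sᶜ
  rw [Set.union_compl_self, probReal_univ] at this
  linarith

end Chains

theorem mainTheorem5 {d : ℕ} (f : EuclideanSpace ℝ (Fin d) → ℝ) (α β : ℝ)
    (hf : IsConvexSmoothPotential f α β)
    (xstar : EuclideanSpace ℝ (Fin d)) (hxstar : ∀ x, f xstar ≤ f x)
    (η : ℝ) (hη0 : 0 < η) (hηβ : η < 1 / β)
    (m N : ℕ) (hN : 1 ≤ N)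
    {Ω : Type*} [MeasurableSpace Ω] (P : Measure Ω) [IsProbabilityMeasure P]
    (Z : Fin N → ℕ → Ω → EuclideanSpace ℝ (Fin d))
    (hZlaw : ∀ k, ∀ i ∈ Finset.Icc 1 (m + 1),
      HasLaw (Z k i) (stdGaussian (EuclideanSpace ℝ (Fin d))) P)
    (hZindep : iIndepFun (fun p : Fin N × Fin (m + 1) => Z p.1 ((p.2 : ℕ) + 1)) P)
    (δ : ℝ) (hδ : 0 < δ) :
    (∀ a b, Integrable (fun ω => parallelUlaCovariance f η xstar m Z ω a b) P) ∧
    1 - 4 * δ ≤ P.real {ω |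
      matrixOpNorm (parallelUlaCovariance f η xstar m Z ω
          - expectedMatrix P (parallelUlaCovariance f η xstar m Z))
        ≤ 16 / α * max (√((9 * (d : ℝ) + 4 * Real.log δ⁻¹) / N))
            ((9 * (d : ℝ) + 4 * Real.log δ⁻¹) / N)} := by
  have hα := hf.alpha_pos
  have hβ : 0 < β := hα.trans_le hf.alpha_le_beta
  have hηβ' : η * β < 1 := (lt_div_iff₀ hβ).1 hηβ
  have hN0 : (0 : ℝ) < N := by positivity
  set γ := stdGaussian (NoiseSpace d m N)
  have hW := map_noise_eq_stdGaussian hZlaw hZindep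
  set W : Ω → NoiseSpace d m N := fun ω =>
    WithLp.toLp 2 fun p : Fin N × Fin (m + 1) => Z p.1 ((p.2 : ℕ) + 1) ω
  have hWγ : P.map W = γ := hW.map_eq
  set Y : NoiseSpace d m N → Matrix (Fin d) (Fin d) ℝ := fun g =>
    sampleCovariance fun k => chainIterate f η xstar k g with hY
  have hZY : parallelUlaCovariance f η xstar m Z = fun ω => Y (W ω) :=
    funext fun ω => parallelUlaCovariance_eq Z ω
  have hYint : ∀ a b, Integrable (fun g => Y g a b) γ := fun a b =>
    integrable_sampleCovariance_apply
      (fun k a => memLp_chainIterate_apply hf hη0 hηβ' k a) a b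
  have hYc : ∀ a b, Continuous fun g => Y g a b := fun a b =>
    continuous_sampleCovariance_chainIterate_apply hf.contDiff a b
  have hE : expectedMatrix P (fun ω => Y (W ω)) = expectedMatrix γ Y := by
    ext a b
    simp only [expectedMatrix, Matrix.of_apply]
    rw [← hWγ, integral_map hW.aemeasurable (hYc a b).aestronglyMeasurable]
  rw [hZY, hE]
  refine ⟨fun a b => ?_, ?_⟩
  · have := hYint a b
    rw [← hWγ] at this
    exact this.comp_aemeasurable hW.aemeasurable
  -- For `δ ≥ 1/4` the claimed probability is at most `0`. Otherwise `δ⁻¹ > 4 > e`, which gives the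
  -- `t ≥ 1` needed for concentration.
  rcases le_or_gt (1 / 4) δ with hδ4 | hδ4
  · exact le_trans (by linarith) measureReal_nonneg
  obtain ⟨T, hTcard, hT1, hTnet⟩ := exists_quarter_net_unitBall (E := EuclideanSpace ℝ (Fin d))
  rw [finrank_euclideanSpace_fin] at hTcard
  -- Chosen so that `9^d exp (-t) = δ`, which absorbs the cardinality of the net.
  set t : ℝ := d * Real.log 9 + Real.log δ⁻¹ with ht
  have hlogδ : 1 ≤ Real.log δ⁻¹ := by
    rw [Real.le_log_iff_exp_le (by positivity)]
    have : 4 ≤ δ⁻¹ := by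
      rw [le_inv_comm₀ (by norm_num) hδ]
      linarith
    linarith [Real.exp_one_lt_d9]
  have ht1 : 1 ≤ t := by
    have : 0 ≤ (d : ℝ) * Real.log 9 := mul_nonneg (by positivity) (Real.log_nonneg (by norm_num))
    linarith
  have ht4 : 4 * t ≤ 9 * (d : ℝ) + 4 * Real.log δ⁻¹ := by
    have := mul_le_mul_of_nonneg_left log_nine_le (Nat.cast_nonneg (α := ℝ) d)
    linarith
  have hexp : 9 ^ d * Real.exp (-t) = δ := by
    rw [ht, neg_add, Real.exp_add, Real.log_inv, neg_neg, Real.exp_log hδ, Real.exp_neg,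
      Real.exp_nat_mul, Real.exp_log (by norm_num), ← mul_assoc, mul_inv_cancel₀ (by positivity),
      one_mul]
  set S : EuclideanSpace ℝ (Fin d) → NoiseSpace d m N → ℝ := fun v g =>
    sampleVariance fun k => inner ℝ (chainIterate f η xstar k g) v with hS
  set B : EuclideanSpace ℝ (Fin d) → Set (NoiseSpace d m N) := fun v =>
    {g | 4 * (2 / α) * max √(4 * t / N) (4 * t / N) < |S v g - ∫ g', S v g' ∂γ|} with hB
  have hBmeas : ∀ v, MeasurableSet (B v) := fun v => by
    refine (isOpen_lt continuous_const (Continuous.abs (Continuous.sub ?_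
      continuous_const))).measurableSet
    exact continuous_sampleVariance_chainIterate hf.contDiff v
  have hBprob : ∀ v ∈ T, P.real (W ⁻¹' B v) ≤ 2 * Real.exp (-t) := fun v hv => by
    have h1 : P.real (W ⁻¹' B v) = γ.real (B v) := by
      rw [measureReal_def, measureReal_def, ← hWγ,
        Measure.map_apply_of_aemeasurable hW.aemeasurable (hBmeas v)]
    rw [h1]
    exact measureReal_sampleVariance_deviation_le hN
      (fun k => contDiff_inner_chainIterate hf.contDiff k v) (by positivity)
      (sum_inner_chainIterate_sub_sq_le hf hη0 hηβ' (hT1 v hv))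
      (fun k => integral_inner_chainIterate_eq hf.contDiff k ⟨0, hN⟩ v) ht1
  have hquad : ∀ v g, inner ℝ (Matrix.toEuclideanCLM (n := Fin d) (𝕜 := ℝ)
      (Y g - expectedMatrix γ Y) v) v = S v g - ∫ g', S v g' ∂γ := fun v g => by
    rw [map_sub, FunLike.coe_sub, Pi.sub_apply, inner_sub_left, inner_expectedMatrix hYint]
    simp only [hY, inner_sampleCovariance, hS]
  refine one_sub_le_measureReal_of_compl_le ?_
  have hsub : {ω | matrixOpNorm (Y (W ω) - expectedMatrix γ Y)
        ≤ 16 / α * max (√((9 * (d : ℝ) + 4 * Real.log δ⁻¹) / N))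
            ((9 * (d : ℝ) + 4 * Real.log δ⁻¹) / N)}ᶜ ⊆ ⋃ v ∈ T, W ⁻¹' B v := fun ω hω => by
    by_contra hcon
    simp only [Set.mem_iUnion, not_exists, hB, Set.mem_preimage, Set.mem_ofPred_eq,
      not_lt] at hcon
    refine hω ?_
    have hnorm := norm_le_two_mul_of_net (A := Matrix.toEuclideanCLM (n := Fin d) (𝕜 := ℝ)
      (Y (W ω) - expectedMatrix γ Y)) (isSymmetric_toEuclideanCLM fun a b => ?_) hT1 hTnet
      (M := 4 * (2 / α) * max √(4 * t / N) (4 * t / N)) fun v hv => by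
        rw [hquad]
        exact hcon v hv
    · refine hnorm.trans ?_
      have hmax : max √(4 * t / N) (4 * t / N)
          ≤ max (√((9 * (d : ℝ) + 4 * Real.log δ⁻¹) / N))
            ((9 * (d : ℝ) + 4 * Real.log δ⁻¹) / N) := by
        have := div_le_div_of_nonneg_right ht4 hN0.le
        exact max_le_max (Real.sqrt_le_sqrt this) this
      have he : ∀ M : ℝ, 2 * (4 * (2 / α) * M) = 16 / α * M := fun M => by ring
      rw [he]
      exact mul_le_mul_of_nonneg_left hmax (by positivity)
    · simp only [Matrix.sub_apply, expectedMatrix, Matrix.of_apply, hY]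
      simp only [sampleCovariance_comm _ a b]
  calc _ ≤ P.real (⋃ v ∈ T, W ⁻¹' B v) := measureReal_mono hsub (measure_ne_top _ _)
    _ ≤ ∑ v ∈ T, P.real (W ⁻¹' B v) := measureReal_biUnion_finset_le _ _
    _ ≤ ∑ _v ∈ T, 2 * Real.exp (-t) := Finset.sum_le_sum hBprob
    _ = T.card * (2 * Real.exp (-t)) := by rw [Finset.sum_const, nsmul_eq_mul]
    _ ≤ 9 ^ d * (2 * Real.exp (-t)) :=
        mul_le_mul_of_nonneg_right (mod_cast hTcard) (by positivity)
    -- The union bound in fact gives `2δ`.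
    _ ≤ 4 * δ := by linarith
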